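/- A surface is a compact connected two-dimensional topological manifold without boundary. A triangulation $G$ of a surface $S$ is a finite simple graph embedded in $S$ such that every face (component of the complement of $G$ in $S$) is an open disk whose boundary is a $3$-cycle of $G$, where $G$ is not a single $3$-cycle embedded in the sphere. An edge of $G$ is contractible if it lies on exactly two $3$-cycles of $G$ and both of them bound faces; $G$ is irreducible if it has no contractible edge. The link of a vertex $v$ is the cycle of $G$ that is the boundary of the union of the (closed) faces containing $v$. A $3$-cycle is nonseparating if the complement in $S$ of the union of its three edges is connected. Theorem. Let $G$ be an irreducible triangulation of a surface other than the sphere, let $v$ be a vertex of $G$, and let $L$ be the link of $v$. Then there are two nonseparating $3$-cycles $v v_i v_k$ and $v v_j v_l$ of $G$ such that $v_i$, $v_j$, $v_k$, $v_l$ are distinct, one of the two paths from $v_i$ to $v_k$ in the cycle $L$ contains $v_j$, and the other path from $v_i$ to $v_k$ in $L$ contains $v_l$. -/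

import Mathlib

/-- The closed simplex spanned by the finite vertex set `s`, in barycentric coordinates. -/
def closedSimplex {V : Type*} [Fintype V] (s : Finset V) : Set (V → ℝ) :=
  {x | x ∈ stdSimplex ℝ V ∧ ∀ v, v ∉ s → x v = 0}

/-- The geometric realization of the two-dimensional simplicial complex whose vertices are the
elements of `V`, whose edges are the edges of `G`, and whose triangles are the members of
`faces`: the union of the closed simplices of the complex. -/
def complexRealization {V : Type*} [Fintype V] [DecidableEq V] (G : SimpleGraph V)
    (faces : Set (Finset V)) : Set (V → ℝ) :=
  {x | (∃ a, x ∈ closedSimplex {a}) ∨ (∃ a b, G.Adj a b ∧ x ∈ closedSimplex {a, b}) ∨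
    ∃ s ∈ faces, x ∈ closedSimplex s}

/-- A triangulation of the space `S` with (finite) vertex set `V`: a simple graph `G` on `V`
and a set of triangular faces, each bounded by a 3-cycle of `G`, together with a homeomorphism
from the resulting simplicial complex onto `S`. The homeomorphism embeds `G` in `S` so that the
components of the complement of `G` are the open triangles. -/
structure SurfaceTriangulation (S V : Type*) [TopologicalSpace S] [Fintype V]
    [DecidableEq V] where
  /-- the graph formed by the vertices and edges -/
  G : SimpleGraph V
  /-- the triangular faces, given by their sets of three vertices -/
  faces : Set (Finset V)
  /-- each face is bounded by a 3-cycle of the graph -/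
  isNClique_of_mem_faces : ∀ s ∈ faces, G.IsNClique 3 s
  /-- the homeomorphism onto the surface -/
  homeo : complexRealization G faces ≃ₜ S

namespace SurfaceTriangulation

variable {S V : Type*} [TopologicalSpace S] [Fintype V] [DecidableEq V]

/-- The edge `ab` is contractible if it is on exactly two 3-cycles of the graph and both of
them bound faces. (A 3-cycle is given by its set of three pairwise adjacent vertices.) -/
def IsContractible (T : SurfaceTriangulation S V) (a b : V) : Prop :=
  T.G.Adj a b ∧ {s : Finset V | T.G.IsNClique 3 s ∧ a ∈ s ∧ b ∈ s}.ncard = 2 ∧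
    ∀ s : Finset V, T.G.IsNClique 3 s → a ∈ s → b ∈ s → s ∈ T.faces

/-- A triangulation is irreducible if it has no contractible edge. -/
def Irreducible (T : SurfaceTriangulation S V) : Prop :=
  ∀ a b, T.G.Adj a b → ¬ T.IsContractible a b

/-- The subset of the surface formed by the three edges `ab`, `bc`, `ca`. -/
def cycleSet (T : SurfaceTriangulation S V) (a b c : V) : Set S :=
  T.homeo '' {x | x.1 ∈ closedSimplex {a, b} ∪ closedSimplex {b, c} ∪ closedSimplex {c, a}}

/-- `abc` is a 3-cycle of the graph that does not separate the surface. -/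
def IsNonseparatingThreeCycle (T : SurfaceTriangulation S V) (a b c : V) : Prop :=
  T.G.Adj a b ∧ T.G.Adj b c ∧ T.G.Adj c a ∧ IsConnected (T.cycleSet a b c)ᶜ

/-- The link of `v`: the edges `ab` opposite to `v` in the faces `vab` containing `v`. They
form the boundary of the union of the faces containing `v`. -/
def link (T : SurfaceTriangulation S V) (v : V) : SimpleGraph V where
  Adj a b := a ≠ b ∧ {v, a, b} ∈ T.faces
  symm := ⟨fun a b h => ⟨h.1.symm, by rw [Finset.pair_comm b a]; exact h.2⟩⟩
  loopless := ⟨fun _ h => h.1 rfl⟩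

/-- `p` and `q` are the two paths from `a` to `b` in the cycle graph `L`: together they form a
cycle, and this cycle contains every edge of `L`. -/
def AreTheTwoPaths {L : SimpleGraph V} {a b : V} (p q : L.Walk a b) : Prop :=
  p.IsPath ∧ q.IsPath ∧ (p.append q.reverse).IsCycle ∧
    ∀ e ∈ L.edgeSet, e ∈ p.edges ∨ e ∈ q.edges

end SurfaceTriangulation

/-!
Invariance of domain in the plane shows that every edge lies on exactly two faces and that the link
of each vertex, which is connected because a punctured disc is, is a cycle. If the edge `va` is not
contractible, then `a` has a neighbour on the link of `v` to which it is joined by a chord, that is,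
by an edge not on the link. Hence every vertex of the link is an end of a chord, and if a chord `ac`
cuts off a shortest possible path of the link, then a chord `bd` at an interior vertex `b` of that
path must cross it.

The 3-cycles `vac` and `vbd` are then nonseparating. Since `vac` does not bound a face, its
complement is the union of the open stars of the other vertices, so it is enough that
`G - {v, a, c}` is connected. Deleting a vertex keeps a graph connected if its neighbours are
connected to each other afterwards. Delete `c`, whose neighbours form a cycle; then `a`, whose
remaining neighbours form a path; then `v`, whose remaining neighbours form the two open arcs from
`a` to `c` of its link, which are joined by the edge `bd`.
-/

section ContinuousLog

open Metric Set unitInterval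

variable {A B : Type*} [TopologicalSpace A] [TopologicalSpace B]

/-- `f` has a continuous logarithm: it factors through the covering `Complex.exp` of the punctured
plane. For a nonvanishing `f` on a circle this says that the winding number of `f` about `0`
vanishes. -/
def HasContinuousLog (f : A → ℂ) : Prop :=
  ∃ g : A → ℂ, Continuous g ∧ ∀ a, Complex.exp (g a) = f a

theorem HasContinuousLog.comp {f : A → ℂ} (hf : HasContinuousLog f) {g : B → A}
    (hg : Continuous g) : HasContinuousLog (f ∘ g) :=
  let ⟨l, hl, hlf⟩ := hf
  ⟨l ∘ g, hl.comp hg, fun b => hlf (g b)⟩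

theorem HasContinuousLog.of_homotopy {F : I × A → ℂ} (hF : Continuous F) (hF₀ : ∀ x, F x ≠ 0)
    (h : HasContinuousLog fun a => F (0, a)) : HasContinuousLog fun a => F (1, a) := by
  obtain ⟨g, hg, hgF⟩ := h
  let F' : C(I × A, {z : ℂ // z ≠ 0}) := ⟨fun x => ⟨F x, hF₀ x⟩, by fun_prop⟩
  have hF'g : ∀ a, F' (0, a) = ⟨Complex.exp (g a), Complex.exp_ne_zero _⟩ :=
    fun a => Subtype.ext (hgF a).symm
  let L := Complex.isCoveringMap_exp.liftHomotopy F' ⟨g, hg⟩ hF'g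
  refine ⟨fun a => L (1, a), by fun_prop, fun a => ?_⟩
  exact congrArg Subtype.val
    (congrFun (Complex.isCoveringMap_exp.liftHomotopy_lifts F' ⟨g, hg⟩ hF'g) (1, a))

theorem hasContinuousLog_restrict_of_starConvex {E : Type*} [AddCommGroup E] [Module ℝ E]
    [TopologicalSpace E] [ContinuousSMul ℝ E] {s : Set E} (hs : StarConvex ℝ 0 s) {f : E → ℂ}
    (hf : ContinuousOn f s) (hf₀ : ∀ x ∈ s, f x ≠ 0) : HasContinuousLog fun x : s => f x := by
  have hmem : ∀ x : I × s, (x.1 : ℝ) • (x.2 : E) ∈ s := fun x =>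
    starConvex_zero_iff.mp hs x.2.2 x.1.2.1 x.1.2.2
  have hlog := HasContinuousLog.of_homotopy (F := fun x : I × s => f ((x.1 : ℝ) • (x.2 : E)))
    (hf.comp_continuous (by fun_prop) hmem) (fun x => hf₀ _ (hmem x))
    ⟨fun _ => Complex.log (f 0), continuous_const, fun a => ?_⟩
  · simpa only [Icc.coe_one, one_smul] using hlog
  · have hmem₀ := hmem (0, a)
    simp only [Icc.coe_zero, zero_smul] at hmem₀ ⊢
    exact Complex.exp_log (hf₀ 0 hmem₀)

theorem HasContinuousLog.sub_of_forall_notMem_segment {f : A → ℂ} (hf : Continuous f) {p q : ℂ}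
    (hpq : ∀ a, f a ∉ segment ℝ p q) (h : HasContinuousLog fun a => f a - p) :
    HasContinuousLog fun a => f a - q := by
  have hlog := HasContinuousLog.of_homotopy
    (F := fun x : I × A => f x.2 - AffineMap.lineMap p q (x.1 : ℝ)) (by fun_prop)
    (fun x => sub_ne_zero.mpr fun hx => hpq x.2 <| by
      rw [hx, segment_eq_image_lineMap]
      exact mem_image_of_mem _ x.1.2)
    (by simpa using h)
  simpa using hlog

theorem not_hasContinuousLog_of_odd {f : sphere (0 : ℂ) 1 → ℂ} (hf : ∀ z, f (-z) = -f z) :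
    ¬ HasContinuousLog f := by
  rintro ⟨g, hg, hgf⟩
  have : PreconnectedSpace (sphere (0 : ℂ) 1) := isPreconnected_iff_preconnectedSpace.mp <|
    isPreconnected_sphere (by rw [Complex.rank_real_complex]; norm_num) 0 1
  have hdiff : ∀ z, ∃ k : ℤ, g (-z) - g z = (2 * k + 1) * (Real.pi * Complex.I) := fun z => by
    have hexp : Complex.exp (g (-z)) = Complex.exp (g z + Real.pi * Complex.I) := by
      rw [Complex.exp_add, Complex.exp_pi_mul_I, hgf, hgf, hf, mul_neg_one]
    obtain ⟨k, hk⟩ := Complex.exp_eq_exp_iff_exists_int.mp hexp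
    exact ⟨k, by rw [hk]; ring⟩
  choose k hk using hdiff
  have hk_cont : Continuous k := by
    refine Int.isClosedEmbedding_coe_real.isInducing.continuous_iff.mpr ?_
    have : ((↑) : ℤ → ℝ) ∘ k = fun z => ((g (-z) - g z).im / Real.pi - 1) / 2 := by
      funext z
      simp [hk z, Real.pi_ne_zero]
    rw [this]
    fun_prop
  have z : sphere (0 : ℂ) 1 := ⟨1, by simp⟩
  have hk_neg : k (-z) = k z := PreconnectedSpace.constant ‹_› hk_cont
  have hk_neg' := hk (-z)
  rw [neg_neg, hk_neg] at hk_neg'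
  have hzero : (2 * k z + 1) * (Real.pi * Complex.I) = 0 := by
    linear_combination (-hk z - hk_neg') / 2
  have hodd : 2 * k z + 1 = 0 := by
    have : (2 * k z + 1 : ℂ) = 0 := by simpa [Real.pi_ne_zero] using hzero
    exact_mod_cast this
  omega

theorem not_hasContinuousLog_sub_of_injOn_closedBall {f : ℂ → ℂ}
    (hf : ContinuousOn f (closedBall 0 1)) (hinj : InjOn f (closedBall 0 1)) :
    ¬ HasContinuousLog fun z : sphere (0 : ℂ) 1 => f z - f 0 := by
  intro h
  have hmem : ∀ (t : ℝ) (z : sphere (0 : ℂ) 1), |t| ≤ 1 → (t : ℂ) * z ∈ closedBall (0 : ℂ) 1 :=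
    fun t z ht => by simpa [norm_eq_of_mem_sphere z] using ht
  have hmem₁ : ∀ x : I × sphere (0 : ℂ) 1,
      ((1 - (x.1 : ℝ) / 2 : ℝ) : ℂ) * x.2 ∈ closedBall (0 : ℂ) 1 := fun x =>
    hmem _ _ (abs_le.mpr ⟨by linarith [x.1.2.2], by linarith [x.1.2.1]⟩)
  have hmem₂ : ∀ x : I × sphere (0 : ℂ) 1,
      ((-((x.1 : ℝ) / 2) : ℝ) : ℂ) * x.2 ∈ closedBall (0 : ℂ) 1 := fun x =>
    hmem _ _ (abs_le.mpr ⟨by linarith [x.1.2.2], by linarith [x.1.2.1]⟩)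
  -- The difference of the values of `f` at points dividing a diameter is homotopic to an odd map.
  have hlog := HasContinuousLog.of_homotopy
    (F := fun x : I × sphere (0 : ℂ) 1 =>
      f ((1 - (x.1 : ℝ) / 2 : ℝ) * x.2) - f ((-((x.1 : ℝ) / 2) : ℝ) * x.2))
    ((hf.comp_continuous (by fun_prop) hmem₁).sub (hf.comp_continuous (by fun_prop) hmem₂))
    (fun x => sub_ne_zero.mpr fun hx => by
      have heq := mul_right_cancel₀ (ne_zero_of_mem_unit_sphere x.2) (hinj (hmem₁ x) (hmem₂ x) hx)
      have : 1 - (x.1 : ℝ) / 2 = -((x.1 : ℝ) / 2) := by exact_mod_cast heq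
      linarith)
    (by simpa using h)
  refine not_hasContinuousLog_of_odd (fun z => ?_) hlog
  norm_num

end ContinuousLog

section InvarianceOfDomain

open Metric Set Topology

theorem image_closedBall_mem_nhds_of_injOn {f : ℂ → ℂ} (hf : ContinuousOn f (closedBall 0 1))
    (hinj : InjOn f (closedBall 0 1)) : f '' closedBall 0 1 ∈ 𝓝 (f 0) := by
  have hclosed : IsClosed (f '' sphere (0 : ℂ) 1) :=
    ((isCompact_sphere _ _).image_of_continuousOn (hf.mono sphere_subset_closedBall)).isClosed
  have hnotMem : f 0 ∉ f '' sphere (0 : ℂ) 1 := by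
    rintro ⟨z, hz, hfz⟩
    have hz₀ := hinj (sphere_subset_closedBall hz) (mem_closedBall_self zero_le_one) hfz
    simp [hz₀] at hz
  obtain ⟨ε, hε, hball⟩ := Metric.isOpen_iff.mp hclosed.isOpen_compl (f 0) hnotMem
  refine Filter.mem_of_superset (ball_mem_nhds _ hε) fun p hp => ?_
  by_contra hpf
  have hlog : HasContinuousLog fun z : sphere (0 : ℂ) 1 => f z - p :=
    (hasContinuousLog_restrict_of_starConvex
      ((convex_closedBall (0 : ℂ) 1).starConvex (mem_closedBall_self zero_le_one))
      (hf.sub continuousOn_const) fun z hz => sub_ne_zero.mpr fun h => hpf ⟨z, hz, h⟩).comp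
      (continuous_inclusion sphere_subset_closedBall)
  refine not_hasContinuousLog_sub_of_injOn_closedBall hf hinj
    (hlog.sub_of_forall_notMem_segment ?_ fun z hz => ?_)
  · exact hf.comp_continuous continuous_subtype_val fun z => sphere_subset_closedBall z.2
  · exact hball ((convex_ball (f 0) ε).segment_subset hp (mem_ball_self hε) hz)
      (mem_image_of_mem f z.2)

theorem image_mem_nhds_of_continuousOn_of_injOn {f : ℂ → ℂ} {U : Set ℂ} {x : ℂ} (hU : U ∈ 𝓝 x)
    (hf : ContinuousOn f U) (hinj : InjOn f U) : f '' U ∈ 𝓝 (f x) := by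
  obtain ⟨ε, hε, hsub⟩ := nhds_basis_closedBall.mem_iff.mp hU
  have hmaps : MapsTo (fun z : ℂ => x + ε * z) (closedBall 0 1) U := fun z hz => hsub <| by
    simpa [abs_of_pos hε] using mul_le_of_le_one_right hε.le (mem_closedBall_zero_iff.mp hz)
  have haffine : Function.Injective fun z : ℂ => x + ε * z :=
    (add_right_injective x).comp (mul_right_injective₀ (by exact_mod_cast hε.ne'))
  have himage := image_closedBall_mem_nhds_of_injOn (hf.comp (by fun_prop) hmaps)
    (hinj.comp haffine.injOn hmaps)
  rw [image_comp] at himage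
  simpa using Filter.mem_of_superset himage (image_mono hmaps.image_subset)

variable {X Y : Type*} [TopologicalSpace X] [ChartedSpace ℂ X]
  [TopologicalSpace Y] [ChartedSpace ℂ Y]

theorem isOpenMap_of_injective_of_chartedSpace_complex {f : X → Y} (hf : Continuous f)
    (hinj : Function.Injective f) : IsOpenMap f := by
  refine isOpenMap_iff_nhds_le.mpr fun x U hU => ?_
  let e := chartAt ℂ x
  let e' := chartAt ℂ (f x)
  have hx : x ∈ e.source := mem_chart_source ℂ x
  have hfx : f x ∈ e'.source := mem_chart_source ℂ (f x)
  let D : Set ℂ := e.target ∩ e.symm ⁻¹' (f ⁻¹' U ∩ f ⁻¹' e'.source)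
  have hD : D ∈ 𝓝 (e x) := by
    refine Filter.inter_mem (chart_target_mem_nhds ℂ x) ((e.tendsto_symm hx).eventually_mem ?_)
    exact Filter.inter_mem hU (hf.continuousAt.preimage_mem_nhds (e'.open_source.mem_nhds hfx))
  have himage : (e' ∘ f ∘ e.symm) '' D ∈ 𝓝 ((e' ∘ f ∘ e.symm) (e x)) := by
    refine image_mem_nhds_of_continuousOn_of_injOn hD ?_ ?_
    · exact e'.continuousOn.comp (hf.comp_continuousOn (e.continuousOn_symm.mono inter_subset_left))
        fun w hw => hw.2.2
    · exact e'.injOn.comp (hinj.comp_injOn (e.symm.injOn.mono inter_subset_left)) fun w hw => hw.2.2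
  simp only [Function.comp_apply, e.left_inv hx] at himage
  filter_upwards [e'.open_source.mem_nhds hfx, (e'.continuousAt hfx) himage] with y hy hyD
  obtain ⟨w, hw, hwy⟩ := hyD
  exact e'.injOn hw.2.2 hy hwy ▸ hw.2.1

theorem re_lt_of_injective_of_chartedSpace_complex {f : X → ℂ} (hf : Continuous f)
    (hinj : Function.Injective f) {r : ℝ} (hr : ∀ x, (f x).re ≤ r) (x : X) : (f x).re < r := by
  have hsub : range f ⊆ interior {w | w.re ≤ r} := interior_maximal (range_subset_iff.mpr hr)
    (isOpenMap_of_injective_of_chartedSpace_complex hf hinj).isOpen_range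
  rw [Complex.interior_setOfPred_re_le] at hsub
  exact hsub (mem_range_self x)

theorem isConnected_ball_diff_center {E : Type*} [NormedAddCommGroup E] [NormedSpace ℝ E]
    (hE : 1 < Module.rank ℝ E) (c : E) {r : ℝ} (hr : 0 < r) : IsConnected (ball c r \ {c}) := by
  let φ : OpenPartialHomeomorph E E := OpenPartialHomeomorph.univBall c r
  have himage : φ '' {0}ᶜ = ball c r \ {c} := by
    have hsource : φ.source = univ := OpenPartialHomeomorph.univBall_source c r
    rw [compl_eq_univ_sdiff, ← hsource, φ.injOn.image_sdiff_subset (by simp [hsource]),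
      φ.image_source_eq_target, OpenPartialHomeomorph.univBall_target c hr, image_singleton,
      OpenPartialHomeomorph.univBall_apply_zero]
  rw [← himage]
  exact (isConnected_compl_singleton_of_one_lt_rank hE 0).image _
    (OpenPartialHomeomorph.continuous_univBall c r).continuousOn

theorem exists_mem_nhds_isConnected_diff_singleton {x : X} {N : Set X} (hN : N ∈ 𝓝 x) :
    ∃ W ∈ 𝓝 x, W ⊆ N ∧ IsConnected (W \ {x}) := by
  let e := chartAt ℂ x
  have hx : x ∈ e.source := mem_chart_source ℂ x
  obtain ⟨r, hr, hball⟩ := Metric.mem_nhds_iff.mp <| Filter.inter_mem (chart_target_mem_nhds ℂ x)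
    ((e.tendsto_symm hx).eventually_mem hN)
  have htarget : ball (e x) r ⊆ e.target := hball.trans inter_subset_left
  refine ⟨e.symm '' ball (e x) r, ?_, image_subset_iff.mpr (hball.trans inter_subset_right), ?_⟩
  · simpa [hx] using e.symm.image_mem_nhds (e.map_source hx) (ball_mem_nhds _ hr)
  · have hdiff : e.symm '' (ball (e x) r \ {e x}) = e.symm '' ball (e x) r \ {x} := by
      rw [(e.symm.injOn.mono htarget).image_sdiff_subset (by simpa using hr), image_singleton,
        e.left_inv hx]
    rw [← hdiff]
    exact (isConnected_ball_diff_center (by rw [Complex.rank_real_complex]; norm_num) _ hr).image _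
      (e.continuousOn_symm.mono (sdiff_subset.trans htarget))

end InvarianceOfDomain

open Set in
theorem reachable_of_isPreconnected_of_isOpen_cover {X ι : Type*} [TopologicalSpace X]
    {H : SimpleGraph ι} {W : Set X} (hW : IsPreconnected W) {U : ι → Set X}
    (hU : ∀ i, IsOpen (U i)) (hcover : W ⊆ ⋃ i, U i)
    (hadj : ∀ i j, i ≠ j → (W ∩ (U i ∩ U j)).Nonempty → H.Adj i j) {i j : ι}
    (hi : (W ∩ U i).Nonempty) (hj : (W ∩ U j).Nonempty) : H.Reachable i j := by
  have : PreconnectedSpace W := isPreconnected_iff_preconnectedSpace.mp hW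
  have hunion : ⋃ k, (Subtype.val ⁻¹' U k : Set W) = univ := by
    rw [← preimage_iUnion, preimage_eq_univ_iff, Subtype.range_coe]
    exact hcover
  have htrans := (hunion ▸ isPreconnected_univ).transGen_of_iUnion
    (fun k => (hU k).preimage continuous_subtype_val) i j
    (Subtype.preimage_coe_nonempty.mpr hi) (Subtype.preimage_coe_nonempty.mpr hj)
  clear hi hj
  induction htrans using Relation.TransGen.trans_induction_on with
  | @single k l h =>
    obtain ⟨x, hx⟩ := h
    by_cases hkl : k = l
    · rw [hkl]
    · exact (hadj k l hkl ⟨x, x.2, hx⟩).reachable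
  | trans _ _ ih₁ ih₂ => exact ih₁.trans ih₂

section Graph

open SimpleGraph

variable {V : Type*} {G L : SimpleGraph V} {a b : V}

theorem isCycle_append_comm {p : L.Walk a b} {q : L.Walk b a} :
    (p.append q).IsCycle ↔ (q.append p).IsCycle := by
  have hnil : p.append q = .nil ↔ q.append p = .nil := by
    simp only [Walk.eq_nil_iff_nil, Walk.nil_append_iff, and_comm]
  simp only [Walk.isCycle_def, Walk.isTrail_def, Walk.edges_append, Walk.tail_support_append, ne_eq,
    hnil, List.nodup_append_comm (l₁ := p.edges), List.nodup_append_comm (l₁ := p.support.tail)]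

theorem exists_isCycle_forall_mem_edges [Finite V] (hL : L.IsCycles)
    (hreach : ∀ x ∈ L.support, ∀ y ∈ L.support, L.Reachable x y) (ha : a ∈ L.support) :
    ∃ C : L.Walk a a, C.IsCycle ∧ ∀ e ∈ L.edgeSet, e ∈ C.edges := by
  classical
  have := Fintype.ofFinite V
  obtain ⟨C, hC, hverts⟩ := hL.exists_cycle_toSubgraph_verts_eq_connectedComponentSupp
    (c := L.connectedComponentMk a) rfl ha
  refine ⟨C, hC, Sym2.ind fun x y hxy => ?_⟩
  have hx : x ∈ C.toSubgraph.verts :=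
    hverts ▸ ConnectedComponent.sound (hreach x ⟨y, hxy⟩ a ha)
  exact C.adj_toSubgraph_iff_mem_edges.mp ((hC.adj_toSubgraph_iff_of_isCycles hL hx y).mpr hxy)

theorem preconnected_induce_support_diff_start {p : L.Walk a b} (hp : p.IsPath) :
    (L.induce ({x | x ∈ p.support} \ {a})).Preconnected := by
  cases p with
  | nil => exact fun x => absurd (by simpa using x.2.1) x.2.2
  | cons h p =>
    have hset : {x | x ∈ (Walk.cons h p).support} \ {a} = {x | x ∈ p.support} := by
      have ha := (Walk.cons_isPath_iff h p).mp hp |>.2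
      grind [Walk.support_cons]
    exact hset ▸ p.connected_induce_support.preconnected

theorem preconnected_induce_support_diff_end {p : L.Walk a b} (hp : p.IsPath) :
    (L.induce ({x | x ∈ p.support} \ {b})).Preconnected := by
  have hset : {x | x ∈ p.reverse.support} = {x | x ∈ p.support} := by
    simp only [Walk.support_reverse, List.mem_reverse]
  exact hset ▸ preconnected_induce_support_diff_start hp.reverse

theorem preconnected_induce_support_diff_ends {p : L.Walk a b} (hp : p.IsPath) :
    (L.induce ({x | x ∈ p.support} \ {a, b})).Preconnected := by
  cases p with
  | nil => exact fun x => absurd (by simpa using x.2.1) (by simpa using x.2.2)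
  | cons h p =>
    obtain ⟨hp', ha⟩ := (Walk.cons_isPath_iff h p).mp hp
    have hset : {x | x ∈ (Walk.cons h p).support} \ {a, b} = {x | x ∈ p.support} \ {b} := by
      grind [Walk.support_cons]
    exact hset ▸ preconnected_induce_support_diff_end hp'

theorem preconnected_induce_support_diff_of_isCycle {p : L.Walk a a} (hp : p.IsCycle) :
    (L.induce ({x | x ∈ p.support} \ {a})).Preconnected := by
  cases p with
  | nil => exact absurd hp Walk.not_isCycle_nil
  | cons h p =>
    have hset : {x | x ∈ (Walk.cons h p).support} \ {a} = {x | x ∈ p.support} \ {a} := by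
      grind [Walk.support_cons]
    exact hset ▸ preconnected_induce_support_diff_end ((Walk.cons_isCycle_iff p h).mp hp).1

theorem setOf_mem_support_subset_of_not_nil {p : L.Walk a b} (hp : ¬ p.Nil) :
    {x | x ∈ p.support} ⊆ L.support := by
  intro x hx
  obtain ⟨e, he, hxe⟩ := (Walk.mem_support_iff_exists_mem_edges_of_not_nil hp).mp hx
  obtain ⟨y, rfl⟩ := hxe
  exact ⟨y, p.edges_subset_edgeSet he⟩

theorem preconnected_induce_support (hreach : ∀ x ∈ L.support, ∀ y ∈ L.support, L.Reachable x y) :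
    (L.induce L.support).Preconnected := by
  intro x y
  by_cases hxy : x = y
  · rw [hxy]
  obtain ⟨p⟩ := hreach x x.2 y y.2
  have hp : ¬ p.Nil := fun h => hxy (Subtype.ext h.eq)
  exact (p.connected_induce_support ⟨x, p.start_mem_support⟩ ⟨y, p.end_mem_support⟩).map
    (induceHomOfLE L (setOf_mem_support_subset_of_not_nil hp)).toHom

theorem preconnected_induce_support_diff_singleton [Finite V] (hL : L.IsCycles)
    (hreach : ∀ x ∈ L.support, ∀ y ∈ L.support, L.Reachable x y) (ha : a ∈ L.support) :
    (L.induce (L.support \ {a})).Preconnected := by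
  obtain ⟨C, hC, hedges⟩ := exists_isCycle_forall_mem_edges hL hreach ha
  have hsupport : {x | x ∈ C.support} = L.support :=
    (setOf_mem_support_subset_of_not_nil hC.not_nil).antisymm
      fun x ⟨y, hxy⟩ => C.fst_mem_support_of_mem_edges (hedges _ hxy)
  exact hsupport ▸ preconnected_induce_support_diff_of_isCycle hC

theorem preconnected_induce_diff_singleton {s t : Set V} (hs : (G.induce s).Preconnected)
    (ht : (G.induce t).Preconnected) (hts : t ⊆ s \ {a}) (ha : G.neighborSet a ∩ s ⊆ t) :
    (G.induce (s \ {a})).Preconnected := by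
  have hwalk : ∀ {x y : s} (_ : (G.induce s).Walk x y) (hy : y.1 ∈ s \ {a}) (z : V)
      (hz : z ∈ s \ {a}), z = x ∨ (x : V) = a ∧ z ∈ t →
      (G.induce (s \ {a})).Reachable ⟨z, hz⟩ ⟨y, hy⟩ := by
    intro x y p
    induction p with
    | nil =>
      rintro hy z hz (rfl | ⟨rfl, -⟩)
      exacts [.rfl, absurd rfl hy.2]
    | @cons x w y h _ ih =>
      have hxw : G.Adj x w := h
      rintro hy z hz (rfl | ⟨rfl, hzt⟩)
      · by_cases hwa : (w : V) = a
        · exact ih hy x hz (.inr ⟨hwa, ha ⟨hwa ▸ hxw.symm, x.2⟩⟩)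
        · exact .trans (Adj.reachable (induce_adj.mpr hxw)) (ih hy w ⟨w.2, hwa⟩ (.inl rfl))
      · have hwt : (w : V) ∈ t := ha ⟨hxw, w.2⟩
        exact .trans ((ht ⟨z, hzt⟩ ⟨w, hwt⟩).map (induceHomOfLE G hts).toHom)
          (ih hy w (hts hwt) (.inl rfl))
  intro x y
  obtain ⟨p⟩ := hs ⟨x, x.2.1⟩ ⟨y, y.2.1⟩
  exact hwalk p y.2 x x.2 (.inl rfl)

end Graph

namespace SurfaceTriangulation

open SimpleGraph

variable {V : Type*} {L : SimpleGraph V} {a b c d : V}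

theorem AreTheTwoPaths.of_isCycle {p q : L.Walk a b} (hab : a ≠ b)
    (hC : (p.append q.reverse).IsCycle) (hL : ∀ e ∈ L.edgeSet, e ∈ p.edges ∨ e ∈ q.edges) :
    AreTheTwoPaths p q :=
  ⟨hC.isPath_of_append_left (Walk.not_nil_of_ne hab.symm),
    by simpa using hC.isPath_of_append_right (Walk.not_nil_of_ne hab), hC, hL⟩

theorem AreTheTwoPaths.mem_support {p q : L.Walk a b} (h : AreTheTwoPaths p q)
    (hc : c ∈ L.support) : c ∈ p.support ∨ c ∈ q.support :=
  let ⟨_, hcd⟩ := hc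
  (h.2.2.2 _ hcd).imp p.fst_mem_support_of_mem_edges q.fst_mem_support_of_mem_edges

theorem AreTheTwoPaths.union_support {p q : L.Walk a b} (h : AreTheTwoPaths p q) (hab : a ≠ b) :
    {x | x ∈ p.support} ∪ {x | x ∈ q.support} = L.support :=
  (Set.union_subset (setOf_mem_support_subset_of_not_nil (Walk.not_nil_of_ne hab))
    (setOf_mem_support_subset_of_not_nil (Walk.not_nil_of_ne hab))).antisymm
    fun _ => h.mem_support

theorem AreTheTwoPaths.subpath {p : L.Walk a b} {q : L.Walk b c} {r : L.Walk c d}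
    {w : L.Walk a d} (h : AreTheTwoPaths (p.append (q.append r)) w) (hbc : b ≠ c) :
    AreTheTwoPaths q (p.reverse.append (w.append r.reverse)) := by
  refine .of_isCycle hbc ?_ fun e he => ?_
  · have hC := h.2.2.1
    rw [← Walk.append_assoc, isCycle_append_comm] at hC
    simpa [Walk.append_assoc] using hC
  · simpa [or_assoc, or_comm, or_left_comm] using h.2.2.2 e he

theorem exists_areTheTwoPaths {x : V} {C : L.Walk x x} (hC : C.IsCycle)
    (hL : ∀ e ∈ L.edgeSet, e ∈ C.edges) (hab : a ≠ b) (ha : a ∈ L.support) (hb : b ∈ L.support) :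
    ∃ p q : L.Walk a b, AreTheTwoPaths p q := by
  have hsupport : ∀ y ∈ L.support, y ∈ C.support := fun y ⟨z, hyz⟩ =>
    C.fst_mem_support_of_mem_edges (hL _ hyz)
  obtain ⟨u, w, rfl⟩ := Walk.mem_support_iff_exists_append.mp (hsupport a ha)
  have hb' : b ∈ (w.append u).support := by
    simpa [or_comm] using hsupport b hb
  obtain ⟨p, q, hpq⟩ := Walk.mem_support_iff_exists_append.mp hb'
  refine ⟨p, q.reverse, .of_isCycle hab ?_ fun e he => ?_⟩
  · rwa [Walk.reverse_reverse, ← hpq, isCycle_append_comm]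
  · rw [Walk.edges_reverse, List.mem_reverse, ← List.mem_append, ← Walk.edges_append, ← hpq]
    simpa [or_comm] using hL e he

/-- In the cycle graph `L`, the distinct vertices `b` and `d` lie on different paths from `a` to
`c`; equivalently, `a`, `b`, `c`, `d` occur on the cycle in this cyclic order. -/
def Interlaced (L : SimpleGraph V) (a b c d : V) : Prop :=
  [a, b, c, d].Nodup ∧ ∃ p q : L.Walk a c, AreTheTwoPaths p q ∧ b ∈ p.support ∧ d ∈ q.support

theorem Interlaced.rotate (h : Interlaced L a b c d) : Interlaced L b c d a := by
  obtain ⟨hne, p, q, hpq, hb, hd⟩ := h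
  refine ⟨List.nodup_rotate (n := 1).mpr hne, ?_⟩
  obtain ⟨p₁, p₂, rfl⟩ := Walk.mem_support_iff_exists_append.mp hb
  obtain ⟨q₁, q₂, rfl⟩ := Walk.mem_support_iff_exists_append.mp hd
  refine ⟨p₂.append q₂.reverse, p₁.reverse.append q₁, .of_isCycle (by grind) ?_ fun e he => ?_,
    by simp, by simp⟩
  · have hC := hpq.2.2.1
    rw [← Walk.append_assoc, isCycle_append_comm] at hC
    simpa [Walk.append_assoc] using hC
  · simpa [or_assoc, or_comm, or_left_comm] using hpq.2.2.2 e he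

theorem Interlaced.mem_support (h : Interlaced L a b c d) : a ∈ L.support :=
  let ⟨hne, p, _, _⟩ := h
  setOf_mem_support_subset_of_not_nil (p := p) (Walk.not_nil_of_ne (by grind)) p.start_mem_support

theorem Interlaced.preconnected_induce_support_diff {G : SimpleGraph V} (h : Interlaced L a b c d)
    (hLG : L ≤ G) (hbd : G.Adj b d) : (G.induce (L.support \ {a, c})).Preconnected := by
  obtain ⟨hne, p, q, hpq, hb, hd⟩ := h
  have harc : ∀ {r : L.Walk a c}, r.IsPath →
      (G.induce ({x | x ∈ r.support} \ {a, c})).Preconnected := fun hr =>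
    (preconnected_induce_support_diff_ends hr).mono (comap_monotone _ hLG)
  rw [← hpq.union_support (by grind), Set.union_sdiff_distrib]
  exact (connected_induce_union (harc hpq.1) (harc hpq.2.1) ⟨hb, by grind⟩ ⟨hd, by grind⟩
    hbd).preconnected

theorem AreTheTwoPaths.exists_interlaced_chords {H : SimpleGraph V} {a c : V}
    {p q : L.Walk a c} (hpq : AreTheTwoPaths p q) (hac : (H \ L).Adj a c)
    (hchord : ∀ x ∈ L.support, ∃ y ∈ L.support, (H \ L).Adj x y) :
    ∃ a b c d, Interlaced L a b c d ∧ (H \ L).Adj a c ∧ (H \ L).Adj b d := by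
  cases p with
  | nil => exact absurd rfl hac.ne
  | @cons _ b _ hab p =>
    have hbc : b ≠ c := fun h => hac.2 (h ▸ hab)
    obtain ⟨d, hd, hbd⟩ := hchord b ⟨a, hab.symm⟩
    -- A chord at `b` that stays on the `p` side cuts off a shorter path.
    by_cases hdp : d ∈ p.support
    · obtain ⟨p₁, p₂, rfl⟩ := Walk.mem_support_iff_exists_append.mp hdp
      exact (hpq.subpath (p := .cons hab .nil) hbd.ne).exists_interlaced_chords hbd hchord
    · have hda : d ≠ a := fun h => hbd.2 (h ▸ hab.symm)
      have hdc : d ≠ c := fun h => hdp (h ▸ p.end_mem_support)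
      have hdq : d ∈ q.support := (hpq.mem_support hd).resolve_left (by simp [hda, hdp])
      refine ⟨a, b, c, d, ⟨?_, _, q, hpq, by simp, hdq⟩, hac, hbd⟩
      simp [hab.ne, hac.ne, hda.symm, hbc, hbd.ne, hdc.symm]
termination_by p.length

end SurfaceTriangulation

section ClosedSimplex

open Set

variable {V : Type*} [Fintype V] {s t : Finset V} {a b c : V} {z : V → ℝ}

theorem convex_closedSimplex (s : Finset V) : Convex ℝ (closedSimplex s) := by
  intro x hx y hy α β hα hβ hαβ
  refine ⟨convex_stdSimplex ℝ V hx.1 hy.1 hα hβ hαβ, fun v hv => ?_⟩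
  simp [hx.2 v hv, hy.2 v hv]

theorem closedSimplex_mono (h : s ⊆ t) : closedSimplex s ⊆ closedSimplex t :=
  fun _ hz => ⟨hz.1, fun v hv => hz.2 v fun hvs => hv (h hvs)⟩

theorem mem_of_mem_closedSimplex_of_ne_zero (hz : z ∈ closedSimplex s) (ha : z a ≠ 0) : a ∈ s :=
  of_not_not fun h => ha (hz.2 a h)

theorem single_mem_closedSimplex [DecidableEq V] (ha : a ∈ s) : Pi.single a 1 ∈ closedSimplex s :=
  ⟨single_mem_stdSimplex ℝ a, fun _ hv => Pi.single_eq_of_ne (ne_of_mem_of_not_mem ha hv).symm 1⟩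

theorem add_single_mem_closedSimplex [DecidableEq V] {x y z : ℝ} (hx : 0 ≤ x) (hy : 0 ≤ y)
    (hz : 0 ≤ z) (hxyz : x + y + z = 1) :
    Pi.single a x + Pi.single b y + Pi.single c z ∈ closedSimplex {a, b, c} := by
  have hsum := (convex_closedSimplex {a, b, c}).sum_mem (t := Finset.univ) (w := ![x, y, z])
    (z := ![Pi.single a 1, Pi.single b 1, Pi.single c 1])
    (by simp [Fin.forall_fin_succ, hx, hy, hz]) (by simp [Fin.sum_univ_three, hxyz])
    (by simp [Fin.forall_fin_succ, single_mem_closedSimplex])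
  simpa [Fin.sum_univ_three, ← Pi.single_smul] using hsum

theorem half_add_half_mem_closedSimplex [DecidableEq V] :
    Pi.single a (1 / 2) + Pi.single b (1 / 2) ∈ closedSimplex {a, b} := by
  simpa using add_single_mem_closedSimplex (a := a) (b := b) (c := b) one_half_pos.le
    one_half_pos.le le_rfl (by norm_num)

theorem eq_of_mem_stdSimplex_of_forall_ne {w : V → ℝ} (hz : z ∈ stdSimplex ℝ V)
    (hw : w ∈ stdSimplex ℝ V) (h : ∀ c ≠ a, z c = w c) : z = w := by
  classical
  have hsum := hz.2.trans hw.2.symm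
  rw [← Finset.add_sum_erase _ z (Finset.mem_univ a), ← Finset.add_sum_erase _ w
    (Finset.mem_univ a), Finset.sum_congr rfl fun c hc => h c (Finset.ne_of_mem_erase hc),
    add_left_inj] at hsum
  ext c
  rcases eq_or_ne c a with rfl | hc
  exacts [hsum, h c hc]

theorem closedSimplex_subset_closure_apply_ne_zero (hb : b ∈ s) :
    closedSimplex s ⊆ closure {z ∈ closedSimplex s | z b ≠ 0} := by
  classical
  intro x hx
  refine closure_mono ?_ (segment_subset_closure_openSegment (left_mem_segment ℝ x (Pi.single b 1)))
  rintro _ ⟨α, β, hα, hβ, hαβ, rfl⟩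
  refine ⟨convex_closedSimplex s hx (single_mem_closedSimplex hb) hα.le hβ.le hαβ, ?_⟩
  have hxb := mul_nonneg hα.le (hx.1.1 b)
  simpa using (by positivity : α * x b + β ≠ 0)

end ClosedSimplex

namespace SurfaceTriangulation

open SimpleGraph Set Topology

variable {S V : Type*} [TopologicalSpace S] [Fintype V] [DecidableEq V]
  (T : SurfaceTriangulation S V) {s : Finset V} {a b c u v : V} {z : V → ℝ}

/-- The geometric realization of the simplicial complex underlying `T`, as a subspace of `V → ℝ`. -/
abbrev realization : Set (V → ℝ) :=
  complexRealization T.G T.faces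

/-- The vertex sets of the simplices (vertices, edges and faces) of `T`. -/
def simplices : Set (Finset V) :=
  {s | (∃ a, s = {a}) ∨ (∃ a b, T.G.Adj a b ∧ s = {a, b}) ∨ s ∈ T.faces}

variable {T}

theorem mem_realization_iff : z ∈ T.realization ↔ ∃ s ∈ T.simplices, z ∈ closedSimplex s := by
  constructor
  · rintro (⟨a, hz⟩ | ⟨a, b, hab, hz⟩ | ⟨s, hs, hz⟩)
    exacts [⟨_, .inl ⟨a, rfl⟩, hz⟩, ⟨_, .inr (.inl ⟨a, b, hab, rfl⟩), hz⟩, ⟨s, .inr (.inr hs), hz⟩]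
  · rintro ⟨s, ⟨a, rfl⟩ | ⟨a, b, hab, rfl⟩ | hs, hz⟩
    exacts [.inl ⟨a, hz⟩, .inr (.inl ⟨a, b, hab, hz⟩), .inr (.inr ⟨s, hs, hz⟩)]

theorem closedSimplex_subset_realization (hs : s ∈ T.simplices) :
    closedSimplex s ⊆ T.realization :=
  fun _ hz => mem_realization_iff.mpr ⟨s, hs, hz⟩

theorem pair_mem_simplices (h : T.G.Adj a b) : {a, b} ∈ T.simplices :=
  .inr (.inl ⟨a, b, h, rfl⟩)

theorem mem_simplices_of_mem_faces (h : s ∈ T.faces) : s ∈ T.simplices :=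
  .inr (.inr h)

theorem isClique_of_mem_simplices (hs : s ∈ T.simplices) : T.G.IsClique s := by
  rcases hs with ⟨a, rfl⟩ | ⟨a, b, hab, rfl⟩ | hs
  · simp
  · simpa [isClique_pair] using fun _ => hab
  · exact (T.isNClique_of_mem_faces s hs).isClique

theorem card_le_three_of_mem_simplices (hs : s ∈ T.simplices) : s.card ≤ 3 := by
  rcases hs with ⟨a, rfl⟩ | ⟨a, b, -, rfl⟩ | hs
  · simp
  · exact Finset.card_le_two.trans (by norm_num)
  · exact (T.isNClique_of_mem_faces s hs).card_eq.le

theorem mem_faces_of_mem_simplices_of_card_eq_three (hs : s ∈ T.simplices) (h : s.card = 3) :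
    s ∈ T.faces := by
  rcases hs with ⟨a, rfl⟩ | ⟨a, b, -, rfl⟩ | hs
  · simp at h
  · have := Finset.card_le_two (a := a) (b := b)
    omega
  · exact hs

theorem mem_stdSimplex_of_mem_realization (hz : z ∈ T.realization) : z ∈ stdSimplex ℝ V :=
  let ⟨_, _, hzs⟩ := mem_realization_iff.mp hz
  hzs.1

theorem adj_of_apply_ne_zero (hz : z ∈ T.realization) (hab : a ≠ b) (ha : z a ≠ 0) (hb : z b ≠ 0) :
    T.G.Adj a b := by
  obtain ⟨s, hs, hzs⟩ := mem_realization_iff.mp hz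
  exact isClique_of_mem_simplices hs (mem_of_mem_closedSimplex_of_ne_zero hzs ha)
    (mem_of_mem_closedSimplex_of_ne_zero hzs hb) hab

theorem mem_faces_of_apply_ne_zero (hz : z ∈ T.realization) (hab : a ≠ b) (hac : a ≠ c)
    (hbc : b ≠ c) (ha : z a ≠ 0) (hb : z b ≠ 0) (hc : z c ≠ 0) : {a, b, c} ∈ T.faces := by
  obtain ⟨s, hs, hzs⟩ := mem_realization_iff.mp hz
  have hcard : ({a, b, c} : Finset V).card = 3 :=
    Finset.card_eq_three.mpr ⟨a, b, c, hab, hac, hbc, rfl⟩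
  have hsub : {a, b, c} ⊆ s := by
    simp [Finset.insert_subset_iff, mem_of_mem_closedSimplex_of_ne_zero hzs, ha, hb, hc]
  have heq := Finset.eq_of_subset_of_card_le hsub (hcard ▸ card_le_three_of_mem_simplices hs)
  exact mem_faces_of_mem_simplices_of_card_eq_three (heq ▸ hs) hcard

/-- The vertex `u`, as a point of the geometric realization. -/
def vertex (T : SurfaceTriangulation S V) (u : V) : T.realization :=
  ⟨Pi.single u 1, closedSimplex_subset_realization (.inl ⟨u, rfl⟩)
    (single_mem_closedSimplex (by simp))⟩

theorem exists_apply_ne_zero_of_ne_vertex {z : T.realization} (hz : z ≠ T.vertex u) :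
    ∃ c ≠ u, z.1 c ≠ 0 := by
  by_contra! h
  exact hz (Subtype.ext (eq_of_mem_stdSimplex_of_forall_ne
    (mem_stdSimplex_of_mem_realization z.2) (single_mem_stdSimplex ℝ u)
    fun c hc => (h c hc).trans (Pi.single_eq_of_ne (M := fun _ => ℝ) hc 1).symm))

/-- The open star of the vertex `u`: the union of the open simplices having `u` as a vertex. -/
def openStar (T : SurfaceTriangulation S V) (u : V) : Set T.realization :=
  {z | z.1 u ≠ 0}

theorem isOpen_openStar (u : V) : IsOpen (T.openStar u) :=
  isOpen_ne_fun ((continuous_apply u).comp continuous_subtype_val) continuous_const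

theorem starConvex_coe_openStar (u : V) :
    StarConvex ℝ (Pi.single u 1) (Subtype.val '' T.openStar u) := by
  rintro _ ⟨z, hzu, rfl⟩ α β hα hβ hαβ
  obtain ⟨s, hs, hzs⟩ := mem_realization_iff.mp z.2
  have hu : u ∈ s := mem_of_mem_closedSimplex_of_ne_zero hzs hzu
  have hmem := convex_closedSimplex s (single_mem_closedSimplex hu) hzs hα hβ hαβ
  have hpos : 0 < z.1 u := (hzs.1.1 u).lt_of_ne' hzu
  refine ⟨⟨_, closedSimplex_subset_realization hs hmem⟩, ne_of_gt ?_, rfl⟩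
  rcases hα.eq_or_lt with rfl | hα
  · simpa [show β = 1 by linarith]
  · simpa using add_pos_of_pos_of_nonneg hα (mul_nonneg hβ hpos.le)

variable (T) in
theorem vertex_mem_openStar (u : V) : T.vertex u ∈ T.openStar u := by
  simp [openStar, vertex]

theorem isConnected_openStar (u : V) : IsConnected (T.openStar u) := by
  refine ⟨⟨_, T.vertex_mem_openStar u⟩, IsInducing.subtypeVal.isPreconnected_image.mp ?_⟩
  exact ((starConvex_coe_openStar u).isPathConnected
    ⟨_, T.vertex_mem_openStar u, rfl⟩).isConnected.isPreconnected

theorem openStar_inter_openStar_nonempty (h : T.G.Adj a b) :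
    (T.openStar a ∩ T.openStar b).Nonempty :=
  ⟨⟨_, closedSimplex_subset_realization (pair_mem_simplices h) half_add_half_mem_closedSimplex⟩,
    by simp [openStar, h.ne], by simp [openStar, h.ne']⟩

theorem mem_closure_openStar {z : T.realization} (hs : s ∈ T.simplices) (hz : z.1 ∈ closedSimplex s)
    (ha : a ∈ s) : z ∈ closure (T.openStar a) := by
  rw [closure_subtype]
  refine closure_mono (fun x hx => ?_) (closedSimplex_subset_closure_apply_ne_zero ha hz)
  exact ⟨⟨x, closedSimplex_subset_realization hs hx.1⟩, hx.2, rfl⟩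

theorem iUnion_openStar : ⋃ u, T.openStar u = univ := by
  refine eq_univ_of_forall fun z => mem_iUnion.mpr ?_
  by_contra! h
  have hsum := (mem_stdSimplex_of_mem_realization z.2).2
  simp_all [openStar]

theorem isConnected_biUnion_openStar {A : Set V} (hA : (T.G.induce A).Connected) :
    IsConnected (⋃ u ∈ A, T.openStar u) := by
  rw [biUnion_eq_iUnion]
  have := hA.nonempty
  refine IsConnected.iUnion_of_reflTransGen (fun u => isConnected_openStar u.1) fun u w => ?_
  exact Relation.ReflTransGen.mono (fun _ _ => openStar_inter_openStar_nonempty) _ _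
    ((reachable_iff_reflTransGen u w).mp (hA u w))

theorem preconnected_graph [ConnectedSpace S] : T.G.Preconnected := by
  have : ConnectedSpace T.realization := T.homeo.connectedSpace_iff.mpr inferInstance
  have hne : ∀ u, (univ ∩ T.openStar u).Nonempty := fun u => by
    simpa using (isConnected_openStar u).nonempty
  refine fun x y => reachable_of_isPreconnected_of_isOpen_cover isPreconnected_univ
    (isOpen_openStar (T := T)) iUnion_openStar.ge ?_ (hne x) (hne y)
  rintro a b hab ⟨z, -, ha, hb⟩
  exact adj_of_apply_ne_zero z.2 hab ha hb

theorem preimage_compl_cycleSet (hab : a ≠ b) (hbc : b ≠ c) (hca : c ≠ a)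
    (h : {a, b, c} ∉ T.faces) :
    T.homeo ⁻¹' (T.cycleSet a b c)ᶜ = ⋃ u ∈ ({a, b, c} : Set V)ᶜ, T.openStar u := by
  ext z
  have hz := mem_stdSimplex_of_mem_realization z.2
  rw [preimage_compl, cycleSet, T.homeo.injective.preimage_image, ← not_iff_not, notMem_compl_iff]
  simp only [mem_ofPred_eq, mem_iUnion, openStar, not_exists, not_not]
  constructor
  · rintro ((hz | hz) | hz) u hu <;> exact hz.2 u (by simp_all)
  · intro hu
    have hzero : z.1 a = 0 ∨ z.1 b = 0 ∨ z.1 c = 0 := by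
      by_contra! hne
      exact h (mem_faces_of_apply_ne_zero z.2 hab hca.symm hbc hne.1 hne.2.1 hne.2.2)
    rcases hzero with h₀ | h₀ | h₀
    · exact .inl (.inr ⟨hz, fun u _ => by by_cases u = a <;> simp_all⟩)
    · exact .inr ⟨hz, fun u _ => by by_cases u = b <;> simp_all⟩
    · exact .inl (.inl ⟨hz, fun u _ => by by_cases u = c <;> simp_all⟩)

theorem isConnected_compl_cycleSet (hab : a ≠ b) (hbc : b ≠ c) (hca : c ≠ a)
    (h : {a, b, c} ∉ T.faces) (hconn : (T.G.induce {a, b, c}ᶜ).Connected) :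
    IsConnected (T.cycleSet a b c)ᶜ := by
  rw [← T.homeo.isConnected_preimage, preimage_compl_cycleSet hab hbc hca h]
  exact isConnected_biUnion_openStar hconn

end SurfaceTriangulation

section EdgeChart

open Set

variable {V : Type*} [DecidableEq V] {v a b b₁ b₂ : V} {w : ℂ}

/-- The chart around the midpoint of the edge `va` common to two triangles `vab₁` and `vab₂`: it
maps the real axis into the edge, the upper half-plane into the first triangle and the lower
half-plane into the second. -/
noncomputable def edgeChart (v a b₁ b₂ : V) (w : ℂ) : V → ℝ :=
  Pi.single v (1 / 2 + w.re - |w.im| / 2) + Pi.single a (1 / 2 - w.re - |w.im| / 2) +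
    Pi.single b₁ w.im⁺ + Pi.single b₂ w.im⁻

theorem edgeChart_zero : edgeChart v a b₁ b₂ 0 = Pi.single v (1 / 2) + Pi.single a (1 / 2) := by
  simp [edgeChart]

theorem continuous_edgeChart : Continuous (edgeChart v a b₁ b₂) := by
  refine continuous_pi fun c => ?_
  simp only [edgeChart, Pi.add_apply, Pi.single_apply]
  split_ifs <;> fun_prop

theorem edgeChart_apply_of_ne (hv : b ≠ v) (ha : b ≠ a) (h₁ : b ≠ b₁) (h₂ : b ≠ b₂) :
    edgeChart v a b₁ b₂ w b = 0 := by
  simp [edgeChart, *]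

theorem edgeChart_injective (h : [v, a, b₁, b₂].Nodup) :
    Function.Injective (edgeChart v a b₁ b₂) := by
  intro w w' hww'
  have hpos : w.im⁺ = w'.im⁺ := by
    have := congrFun hww' b₁
    simp_all [edgeChart]
  have hneg : w.im⁻ = w'.im⁻ := by
    have := congrFun hww' b₂
    simp_all [edgeChart]
  have him : w.im = w'.im := by rw [← posPart_sub_negPart w.im, hpos, hneg, posPart_sub_negPart]
  refine Complex.ext ?_ him
  have hre := congrFun hww' v
  clear hww'
  simp_all [edgeChart]

theorem edgeChart_mem_closedSimplex [Fintype V] (hw : ‖w‖ < 1 / 4) :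
    edgeChart v a b₁ b₂ w ∈ closedSimplex {v, a, b₁} ∪ closedSimplex {v, a, b₂} := by
  have hre := abs_lt.mp ((Complex.abs_re_le_norm w).trans_lt hw)
  have him := (Complex.abs_im_le_norm w).trans_lt hw
  rcases le_total 0 w.im with hs | hs
  · left
    have hmem := add_single_mem_closedSimplex (a := v) (b := a) (c := b₁)
      (x := 1 / 2 + w.re - |w.im| / 2) (y := 1 / 2 - w.re - |w.im| / 2) (by linarith)
      (by linarith) hs (by rw [abs_of_nonneg hs]; ring)
    simpa [edgeChart, posPart_of_nonneg hs, negPart_of_nonneg hs] using hmem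
  · right
    have hmem := add_single_mem_closedSimplex (a := v) (b := a) (c := b₂)
      (x := 1 / 2 + w.re - |w.im| / 2) (y := 1 / 2 - w.re - |w.im| / 2) (by linarith)
      (by linarith) (neg_nonneg.mpr hs) (by rw [abs_of_nonpos hs]; ring)
    simpa [edgeChart, posPart_of_nonpos hs, negPart_of_nonpos hs] using hmem

end EdgeChart

namespace SurfaceTriangulation

open SimpleGraph Set Topology

variable {S V : Type*} [TopologicalSpace S] [Fintype V] [DecidableEq V]
  {T : SurfaceTriangulation S V} {a b b₁ b₂ b₃ c v : V}

theorem link_adj : (T.link v).Adj a b ↔ {v, a, b} ∈ T.faces :=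
  ⟨fun h => h.2, fun h => ⟨(is3Clique_triple_iff.mp (T.isNClique_of_mem_faces _ h)).2.2.ne, h⟩⟩

theorem adj_of_link_adj (h : (T.link v).Adj a b) : T.G.Adj v a ∧ T.G.Adj v b ∧ T.G.Adj a b :=
  is3Clique_triple_iff.mp (T.isNClique_of_mem_faces _ (link_adj.mp h))

variable (T) in
theorem link_le (v : V) : T.link v ≤ T.G :=
  fun _ _ h => (adj_of_link_adj h).2.2

variable [ChartedSpace (EuclideanSpace ℝ (Fin 2)) S]

/-- The planar charts of the surface, transported to the geometric realization. -/
noncomputable instance instChartedSpaceRealization : ChartedSpace ℂ T.realization :=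
  let e : EuclideanSpace ℝ (Fin 2) ≃ₜ ℂ := Complex.orthonormalBasisOneI.repr.symm.toHomeomorph
  letI := e.toOpenPartialHomeomorph.singletonChartedSpace rfl
  letI := T.homeo.toOpenPartialHomeomorph.singletonChartedSpace rfl
  letI := ChartedSpace.comp (EuclideanSpace ℝ (Fin 2)) S T.realization
  ChartedSpace.comp ℂ (EuclideanSpace ℝ (Fin 2)) T.realization

theorem exists_link_adj_ne (h : T.G.Adj v a) (b : V) : ∃ c ≠ b, (T.link v).Adj a c := by
  by_contra! hb
  let N : TopologicalSpace.Opens T.realization :=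
    ⟨T.openStar v ∩ T.openStar a, (isOpen_openStar v).inter (isOpen_openStar a)⟩
  have hzero : ∀ z : N, ∀ c, c ≠ v → c ≠ a → c ≠ b → z.1.1 c = 0 := fun z c hcv hca hcb => by
    by_contra hc
    exact hb c hcb (link_adj.mpr (mem_faces_of_apply_ne_zero z.1.2 h.ne hcv.symm hca.symm
      z.2.1 z.2.2 hc))
  -- Near the edge, the realization maps injectively into a half-plane bounded by the edge.
  let ψ : N → ℂ := fun z => ⟨z.1.1 v + z.1.1 a, z.1.1 v⟩
  have hcoord : ∀ c, Continuous fun z : N => z.1.1 c := fun c =>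
    (continuous_apply c).comp (continuous_subtype_val.comp continuous_subtype_val)
  have hψ : Continuous ψ :=
    Complex.equivRealProdCLM.symm.continuous.comp (((hcoord v).add (hcoord a)).prodMk (hcoord v))
  have hinj : Function.Injective ψ := fun z w hzw => by
    obtain ⟨hre, him⟩ := Complex.mk.inj hzw
    refine Subtype.ext (Subtype.ext (eq_of_mem_stdSimplex_of_forall_ne (a := b)
      (mem_stdSimplex_of_mem_realization z.1.2) (mem_stdSimplex_of_mem_realization w.1.2) ?_))
    intro c hcb
    rcases eq_or_ne c v with rfl | hcv
    · exact him
    rcases eq_or_ne c a with rfl | hca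
    · linarith
    rw [hzero z c hcv hca hcb, hzero w c hcv hca hcb]
  have hle : ∀ z, (ψ z).re ≤ 1 := fun z => by
    have hz := mem_stdSimplex_of_mem_realization z.1.2
    calc z.1.1 v + z.1.1 a = ∑ c ∈ {v, a}, z.1.1 c := (Finset.sum_pair h.ne).symm
      _ ≤ ∑ c, z.1.1 c := Finset.sum_le_univ_sum_of_nonneg hz.1
      _ = 1 := hz.2
  let m : T.realization := ⟨_, closedSimplex_subset_realization (pair_mem_simplices h)
    half_add_half_mem_closedSimplex⟩
  have hlt := re_lt_of_injective_of_chartedSpace_complex hψ hinj hle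
    ⟨m, by simp [m, openStar, h.ne], by simp [m, openStar, h.ne']⟩
  norm_num [ψ, m, h.ne, h.ne'] at hlt

theorem isOpen_preimage_image_edgeChart (h : [v, a, b₁, b₂].Nodup) (h₁ : {v, a, b₁} ∈ T.faces)
    (h₂ : {v, a, b₂} ∈ T.faces) :
    IsOpen (X := T.realization)
      (Subtype.val ⁻¹' (edgeChart v a b₁ b₂ '' Metric.ball 0 (1 / 4))) := by
  let D : TopologicalSpace.Opens ℂ := ⟨Metric.ball 0 (1 / 4), Metric.isOpen_ball⟩
  have hmem : ∀ w : D, edgeChart v a b₁ b₂ w ∈ T.realization := fun w =>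
    (edgeChart_mem_closedSimplex (mem_ball_zero_iff.mp w.2)).elim
      (fun hw => closedSimplex_subset_realization (mem_simplices_of_mem_faces h₁) hw)
      (fun hw => closedSimplex_subset_realization (mem_simplices_of_mem_faces h₂) hw)
  let φ : D → T.realization := fun w => ⟨edgeChart v a b₁ b₂ w, hmem w⟩
  have hφ : Continuous φ := (continuous_edgeChart.comp continuous_subtype_val).subtype_mk _
  have hinj : Function.Injective φ := fun w w' hww' =>
    Subtype.ext (edgeChart_injective h (congrArg Subtype.val hww'))
  convert (isOpenMap_of_injective_of_chartedSpace_complex hφ hinj).isOpen_range using 1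
  ext z
  simp [φ, D, Subtype.ext_iff]

theorem eq_or_eq_of_link_adj (h₁ : (T.link v).Adj a b₁) (h₂ : (T.link v).Adj a b₂)
    (h₃ : (T.link v).Adj a b₃) (h₁₂ : b₁ ≠ b₂) : b₃ = b₁ ∨ b₃ = b₂ := by
  by_contra! hne
  obtain ⟨hva, hvb₁, hab₁⟩ := adj_of_link_adj h₁
  obtain ⟨-, hvb₂, hab₂⟩ := adj_of_link_adj h₂
  obtain ⟨-, hvb₃, hab₃⟩ := adj_of_link_adj h₃
  have hnodup : [v, a, b₁, b₂].Nodup := by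
    simp [hva.ne, hvb₁.ne, hvb₂.ne, hab₁.ne, hab₂.ne, h₁₂]
  have hm : edgeChart v a b₁ b₂ 0 ∈ closedSimplex {v, a} := by
    rw [edgeChart_zero]
    exact half_add_half_mem_closedSimplex
  have hclosure := mem_closure_openStar
    (z := ⟨_, closedSimplex_subset_realization (pair_mem_simplices hva) hm⟩) (a := b₃)
    (mem_simplices_of_mem_faces (link_adj.mp h₃)) (closedSimplex_mono (by grind) hm) (by simp)
  obtain ⟨z, ⟨w, -, hwz⟩, hz⟩ := mem_closure_iff.mp hclosure _
    (isOpen_preimage_image_edgeChart hnodup (link_adj.mp h₁) (link_adj.mp h₂)) ⟨0, by simp, rfl⟩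
  exact hz (hwz ▸ edgeChart_apply_of_ne hvb₃.ne' hab₃.ne' hne.1 hne.2)

variable (T) in
theorem support_link (v : V) : (T.link v).support = T.G.neighborSet v :=
  Subset.antisymm (fun _ ⟨_, h⟩ => (adj_of_link_adj h).1) fun _ h =>
    let ⟨c, _, hc⟩ := exists_link_adj_ne h v
    ⟨c, hc⟩

theorem mem_support_link : a ∈ (T.link v).support ↔ T.G.Adj v a := by
  rw [support_link, mem_neighborSet]

variable (T) in
theorem isCycles_link (v : V) : (T.link v).IsCycles := by
  rintro a ⟨b, hb⟩
  obtain ⟨c, hcb, hc⟩ := exists_link_adj_ne (adj_of_link_adj hb).1 b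
  refine ncard_eq_two.mpr ⟨b, c, hcb.symm, Subset.antisymm (fun d hd => ?_) ?_⟩
  · exact eq_or_eq_of_link_adj hb hc hd hcb.symm
  · simp [pair_subset_iff, hb, hc]

end SurfaceTriangulation

section Triangles

open SimpleGraph

variable {V : Type*} [DecidableEq V] {G : SimpleGraph V} {a b : V}

theorem setOf_isNClique_three_eq_image_commonNeighbors (hab : G.Adj a b) :
    {s : Finset V | G.IsNClique 3 s ∧ a ∈ s ∧ b ∈ s} =
      (fun c => {c, a, b}) '' G.commonNeighbors a b := by
  ext s
  constructor
  · rintro ⟨hs, ha, hb⟩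
    obtain ⟨c, -, rfl⟩ := Finset.exists_eq_insert_iff.mpr
      ⟨show {a, b} ⊆ s by grind, by rw [Finset.card_pair hab.ne, hs.card_eq]⟩
    obtain ⟨hca, hcb, -⟩ := is3Clique_triple_iff.mp hs
    exact ⟨c, ⟨hca.symm, hcb.symm⟩, rfl⟩
  · rintro ⟨c, ⟨hac, hbc⟩, rfl⟩
    exact ⟨is3Clique_triple_iff.mpr ⟨hac.symm, hbc.symm, hab⟩, by simp, by simp⟩

theorem injOn_triple_commonNeighbors :
    Set.InjOn (fun c => ({c, a, b} : Finset V)) (G.commonNeighbors a b) := fun c hc d _ hcd => by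
  have hmem : c ∈ ({d, a, b} : Finset V) :=
    (show {c, a, b} = ({d, a, b} : Finset V) from hcd) ▸ Finset.mem_insert_self c _
  simpa [hc.1.ne', hc.2.ne'] using hmem

end Triangles

namespace SurfaceTriangulation

open SimpleGraph Set Topology

variable {S V : Type*} [TopologicalSpace S] [Fintype V] [DecidableEq V]
  {T : SurfaceTriangulation S V} {a b c d v : V}

variable [ChartedSpace (EuclideanSpace ℝ (Fin 2)) S]

variable (T) in
theorem exists_adj (v : V) : ∃ a, T.G.Adj v a := by
  obtain ⟨W, -, hWv, ⟨z, hzW, hz⟩, -⟩ := exists_mem_nhds_isConnected_diff_singleton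
    ((isOpen_openStar v).mem_nhds (T.vertex_mem_openStar v))
  obtain ⟨c, hcv, hc⟩ := exists_apply_ne_zero_of_ne_vertex hz
  exact ⟨c, adj_of_apply_ne_zero z.2 hcv.symm (hWv hzW) hc⟩

theorem reachable_link (ha : T.G.Adj v a) (hb : T.G.Adj v b) : (T.link v).Reachable a b := by
  obtain ⟨W, hW, hWv, hconn⟩ := exists_mem_nhds_isConnected_diff_singleton
    ((isOpen_openStar v).mem_nhds (T.vertex_mem_openStar v))
  let U : V → Set T.realization := fun c => {_z | c ≠ v} ∩ T.openStar c
  have hne : ∀ {c}, T.G.Adj v c → (W \ {T.vertex v} ∩ U c).Nonempty := fun {c} hvc => by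
    have hclosure : T.vertex v ∈ closure (T.openStar c) := mem_closure_openStar
      (pair_mem_simplices hvc) (single_mem_closedSimplex (by simp)) (by simp)
    obtain ⟨z, hzW, hzc⟩ := mem_closure_iff_nhds.mp hclosure W hW
    refine ⟨z, ⟨hzW, ?_⟩, hvc.ne', hzc⟩
    rintro rfl
    simp [openStar, vertex, hvc.ne'] at hzc
  refine reachable_of_isPreconnected_of_isOpen_cover hconn.isPreconnected (U := U)
    (fun c => isOpen_const.inter (isOpen_openStar c)) (fun z hz => ?_) ?_ (hne ha) (hne hb)
  · obtain ⟨c, hcv, hc⟩ := exists_apply_ne_zero_of_ne_vertex hz.2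
    exact mem_iUnion.mpr ⟨c, hcv, hc⟩
  · rintro c d hcd ⟨z, hz, ⟨hcv, hc⟩, hdv, hd⟩
    exact link_adj.mpr (mem_faces_of_apply_ne_zero z.2 hcv.symm hdv.symm hcd (hWv hz.1) hc hd)

theorem reachable_of_mem_support_link :
    ∀ a ∈ (T.link v).support, ∀ b ∈ (T.link v).support, (T.link v).Reachable a b := by
  rw [support_link]
  exact fun a ha b hb => reachable_link ha hb

theorem exists_chord_of_not_isContractible (ha : T.G.Adj v a) (h : ¬ T.IsContractible v a) :
    ∃ b ∈ (T.link v).support, (T.G \ T.link v).Adj a b := by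
  by_contra! hno
  have hnbr : T.G.commonNeighbors v a = (T.link v).neighborSet a := Subset.antisymm
    (fun b hb => of_not_not fun hab => hno b (mem_support_link.mpr hb.1) ⟨hb.2, hab⟩)
    fun b hb => (adj_of_link_adj hb).2
  refine h ⟨ha, ?_, fun s hs hv has => ?_⟩
  · rw [setOf_isNClique_three_eq_image_commonNeighbors ha, injOn_triple_commonNeighbors.ncard_image,
      hnbr]
    exact T.isCycles_link v (mem_support_link.mpr ha)
  · have himage : s ∈ {s : Finset V | T.G.IsNClique 3 s ∧ v ∈ s ∧ a ∈ s} := ⟨hs, hv, has⟩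
    rw [setOf_isNClique_three_eq_image_commonNeighbors ha, hnbr] at himage
    obtain ⟨b, hb, rfl⟩ := himage
    simpa [Finset.insert_comm b, Finset.pair_comm b] using link_adj.mp hb

theorem preconnected_induce_neighborSet (v : V) :
    (T.G.induce (T.G.neighborSet v)).Preconnected := by
  rw [← T.support_link v]
  exact (preconnected_induce_support reachable_of_mem_support_link).mono
    (comap_monotone _ (T.link_le v))

theorem preconnected_induce_neighborSet_diff_singleton (h : T.G.Adj v a) :
    (T.G.induce (T.G.neighborSet v \ {a})).Preconnected := by
  rw [← T.support_link v]
  exact (preconnected_induce_support_diff_singleton (T.isCycles_link v)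
    reachable_of_mem_support_link (mem_support_link.mpr h)).mono (comap_monotone _ (T.link_le v))

theorem connected_induce_compl_of_interlaced [ConnectedSpace S] (h : Interlaced (T.link v) a b c d)
    (hac : T.G.Adj a c) (hbd : T.G.Adj b d) : (T.G.induce {v, a, c}ᶜ).Connected := by
  have hset : ({v, a, c} : Set V)ᶜ = ((univ \ {c}) \ {a}) \ {v} := by grind
  have hb : b ∈ ({v, a, c} : Set V)ᶜ := by
    have hvb : v ≠ b := (mem_support_link.mp h.rotate.mem_support).ne
    grind [h.1]
  have hdel_c : (T.G.induce (univ \ {c})).Preconnected :=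
    preconnected_induce_diff_singleton (T.G.induceUnivIso.preconnected_iff.mpr preconnected_graph)
      (preconnected_induce_neighborSet c) (fun w hw => ⟨trivial, hw.ne'⟩) inter_subset_left
  have hdel_a : (T.G.induce ((univ \ {c}) \ {a})).Preconnected :=
    preconnected_induce_diff_singleton hdel_c (preconnected_induce_neighborSet_diff_singleton hac)
      (fun w hw => ⟨⟨trivial, hw.2⟩, hw.1.ne'⟩) (by grind)
  have hdel_v : (T.G.induce (((univ \ {c}) \ {a}) \ {v})).Preconnected :=
    preconnected_induce_diff_singleton hdel_a
      (h.preconnected_induce_support_diff (T.link_le v) hbd)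
      (fun w hw => by grind [(mem_support_link.mp hw.1).ne])
      (fun w hw => by grind [mem_support_link.mpr hw.1])
  rw [hset] at hb ⊢
  have : Nonempty ↑(((univ \ {c}) \ {a}) \ {v} : Set V) := ⟨⟨b, hb⟩⟩
  exact ⟨hdel_v⟩

theorem isNonseparatingThreeCycle_of_interlaced [ConnectedSpace S]
    (h : Interlaced (T.link v) a b c d) (hac : (T.G \ T.link v).Adj a c) (hbd : T.G.Adj b d) :
    T.IsNonseparatingThreeCycle v a c := by
  have hva : T.G.Adj v a := mem_support_link.mp h.mem_support
  have hvc : T.G.Adj v c := mem_support_link.mp h.rotate.rotate.mem_support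
  exact ⟨hva, hac.1, hvc.symm, isConnected_compl_cycleSet hva.ne hac.ne hvc.ne'
    (fun hface => hac.2 (link_adj.mpr hface)) (connected_induce_compl_of_interlaced h hac.1 hbd)⟩

end SurfaceTriangulation

open SurfaceTriangulation in
theorem theorem5_general {S V : Type*} [TopologicalSpace S] [ConnectedSpace S]
    [ChartedSpace (EuclideanSpace ℝ (Fin 2)) S] [Fintype V] [DecidableEq V]
    (T : SurfaceTriangulation S V) (v : V) (hT : ∀ a, T.G.Adj v a → ¬ T.IsContractible v a) :
    ∃ vi vj vk vl : V, [vi, vj, vk, vl].Nodup ∧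
      T.IsNonseparatingThreeCycle v vi vk ∧ T.IsNonseparatingThreeCycle v vj vl ∧
      ∃ p q : (T.link v).Walk vi vk, AreTheTwoPaths p q ∧ vj ∈ p.support ∧ vl ∈ q.support := by
  have hchord : ∀ a ∈ (T.link v).support, ∃ b ∈ (T.link v).support, (T.G \ T.link v).Adj a b :=
    fun a ha => exists_chord_of_not_isContractible (mem_support_link.mp ha)
      (hT a (mem_support_link.mp ha))
  obtain ⟨a, hva⟩ := T.exists_adj v
  have ha : a ∈ (T.link v).support := mem_support_link.mpr hva
  obtain ⟨c, hc, hac⟩ := hchord a ha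
  obtain ⟨C, hC, hedges⟩ := exists_isCycle_forall_mem_edges (T.isCycles_link v)
    reachable_of_mem_support_link ha
  obtain ⟨p, q, hpq⟩ := exists_areTheTwoPaths hC hedges hac.ne ha hc
  obtain ⟨vi, vj, vk, vl, h, hik, hjl⟩ := hpq.exists_interlaced_chords hac hchord
  exact ⟨vi, vj, vk, vl, h.1, isNonseparatingThreeCycle_of_interlaced h hik hjl.1,
    isNonseparatingThreeCycle_of_interlaced h.rotate hjl hik.1.symm, h.2⟩

theorem theorem5 {S V : Type*} [TopologicalSpace S] [T2Space S] [CompactSpace S]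
    [ConnectedSpace S] [ChartedSpace (EuclideanSpace ℝ (Fin 2)) S]
    (hS : IsEmpty (S ≃ₜ Metric.sphere (0 : EuclideanSpace ℝ (Fin 3)) 1))
    [Fintype V] [DecidableEq V] (T : SurfaceTriangulation S V) (hT : T.Irreducible) (v : V) :
    ∃ vi vj vk vl : V, [vi, vj, vk, vl].Nodup ∧
      T.IsNonseparatingThreeCycle v vi vk ∧ T.IsNonseparatingThreeCycle v vj vl ∧
      ∃ p q : (T.link v).Walk vi vk, SurfaceTriangulation.AreTheTwoPaths p q ∧
        vj ∈ p.support ∧ vl ∈ q.support :=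
  theorem5_general T v fun a => hT v a
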